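/- Let $V$ be a finite-dimensional real inner product space of dimension $n$, and let $\Phi\subset V$ be a pseudo-root system: a finite set of unit vectors such that $s_\beta(\alpha)\in\Phi$ for all $\alpha,\beta\in\Phi$, where $s_\beta$ is the orthogonal reflection in the hyperplane $H_\beta=\beta^\perp$. Let $\Phi^+=\{\alpha\in\Phi : (\alpha,v)>0\}$ be a system of positive pseudo-roots, where $v\in V$ lies on none of the hyperplanes $H_\alpha$, $\alpha\in\Phi$. Let $T_0=\{x\in V : (\alpha,x)\ge 0 \text{ for all } \alpha\in\Phi^+\}$ be the base chamber, and let $W$ be the Coxeter group generated by the reflections $s_\alpha$, $\alpha\in\Phi$. For $w\in W$ let $(-1)^w$ be $-1$ to the number of hyperplanes $H_\alpha$, $\alpha\in\Phi^+$, that separate $w(T_0)$ from $T_0$. A *$2$-structure* for $\Phi$ is a subset $\varphi\subseteq\Phi$ such that (a) $\varphi$ is a disjoint union of pairwise orthogonal irreducible pseudo-root systems, each of type $A_1$, $B_2$ or $I_2(2^j)$ with $j\ge 3$, and (b) with $\varphi^+=\varphi\cap\Phi^+$, every $w\in W$ with $w(\varphi^+)=\varphi^+$ satisfies $(-1)^w=1$.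 Let $\mathcal{T}(\Phi)$ be the set of $2$-structures. The sign of $\varphi\in\mathcal{T}(\Phi)$ is $$\epsilon(\varphi)=\frac{1}{|\{w\in W : w(\varphi^+)=\varphi^+\}|}\sum_{w\in W,\; w(\varphi^+)\subseteq\Phi^+}(-1)^w .$$ (It is the $\pm1$-valued function on $\mathcal{T}(\Phi)$ with $\epsilon(w(\varphi))=(-1)^w\epsilon(\varphi)$ whenever $w\in W$ and $w(\varphi^+)\subseteq\Phi^+$, and with $\sum_{\varphi\in\mathcal{T}(\Phi)}\epsilon(\varphi)=1$.) Assume that all $2$-structures for $\Phi$ have type $A_1^k$, that is, each of them has the form $\{\pm f_1,\dots,\pm f_k\}$ with $f_1,\dots,f_k$ orthonormal. For $m\ge 0$ let $c_m=(-1)^m\binom{(n-k)/2}{m}$, with $\binom{t}{m}=t(t-1)\cdots(t-m+1)/m!$, and let $$T_{2m+k}(x_1,\dots,x_k)=c_m\sum_{r_1+\cdots+r_k=m}\binom{m}{r_1,\dots,r_k}\frac{x_1^{2r_1+1}}{2r_1+1}\cdots\frac{x_k^{2r_k+1}}{2r_k+1};$$ let $T_d=0$ if $d<k$ or if $d$ and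 $k$ have opposite parity. For a set $\psi=\{f_1,\dots,f_k\}$ of $k$ orthonormal vectors put $T_d(\psi;a)=T_d((f_1,a),\dots,(f_k,a))$, and define the polynomial $$Z_d(\Phi;a)=\sum_{\varphi\in\mathcal{T}(\Phi)}\epsilon(\varphi)\,T_d(\varphi^+;a)$$ in the variable $a\in V$. Then, for every $d\ge 0$, the polynomial $Z_d(\Phi;a)$ is skew-symmetric with respect to $W$: $$Z_d(\Phi;w(a))=(-1)^w\,Z_d(\Phi;a)\qquad\text{for all } w\in W,\ a\in V,$$ and the Jacobian $J(a)=\prod_{\alpha\in\Phi^+}(\alpha,a)$ divides $Z_d(\Phi;a)$ in the ring of polynomials on $V$. -/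

import Mathlib

noncomputable section

namespace CoxeterPizza

open scoped InnerProductSpace

/-- The orthogonal reflection `s_α` in the hyperplane `H_α = {x | (α, x) = 0}`. -/
def rootReflection {V : Type*} [NormedAddCommGroup V] [InnerProductSpace ℝ V] (α : V) :
    V ≃ₗᵢ[ℝ] V :=
  (Submodule.span ℝ {α})ᗮ.reflection

/-- A pseudo-root system: a finite set of unit vectors stable under the reflections in its
elements. -/
structure IsPseudoRootSystem {V : Type*} [NormedAddCommGroup V] [InnerProductSpace ℝ V]
    (Φ : Finset V) : Prop where
  norm_eq_one : ∀ α ∈ Φ, ‖α‖ = 1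
  reflection_mem : ∀ α ∈ Φ, ∀ β ∈ Φ, rootReflection β α ∈ Φ

/-- `Φp` is a system of positive pseudo-roots of `Φ`: the pseudo-roots that are positive on a
vector lying on none of the hyperplanes `H_α`, i.e. in the interior of a chamber. -/
def IsPositiveSystem {V : Type*} [NormedAddCommGroup V] [InnerProductSpace ℝ V]
    (Φ Φp : Finset V) : Prop :=
  ∃ v : V, (∀ α ∈ Φ, ⟪α, v⟫_ℝ ≠ 0) ∧ ∀ α : V, α ∈ Φp ↔ α ∈ Φ ∧ 0 < ⟪α, v⟫_ℝ

/-- The Coxeter group `W`, generated by the reflections `s_α`, `α ∈ Φ`. -/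
def coxeterGroup {V : Type*} [NormedAddCommGroup V] [InnerProductSpace ℝ V]
    (Φ : Finset V) : Subgroup (V ≃ₗᵢ[ℝ] V) :=
  Subgroup.closure {s | ∃ α ∈ Φ, s = rootReflection α}

/-- The base chamber `T₀`. -/
def baseChamber {V : Type*} [NormedAddCommGroup V] [InnerProductSpace ℝ V]
    (Φp : Finset V) : Set V :=
  {x | ∀ α ∈ Φp, 0 ≤ ⟪α, x⟫_ℝ}

open Classical in
/-- The sign `(-1)^w`: minus one to the number of hyperplanes `H_α` (`α` a positive pseudo-root)
that separate the chamber `w(T₀)` from the base chamber `T₀`. As `T₀` lies on the positive side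
of every `H_α`, separation means that `w(T₀)` lies on the negative side. -/
def coxeterSign {V : Type*} [NormedAddCommGroup V] [InnerProductSpace ℝ V]
    (Φp : Finset V) (w : V ≃ₗᵢ[ℝ] V) : ℤ :=
  (-1) ^ (Φp.filter fun α => ∀ x ∈ baseChamber Φp, ⟪α, w x⟫_ℝ ≤ 0).card

/-- An irreducible pseudo-root system of type `A₁`. -/
def IsTypeA1 {V : Type*} [NormedAddCommGroup V] [InnerProductSpace ℝ V] (ψ : Finset V) : Prop :=
  ∃ α : V, ‖α‖ = 1 ∧ ∀ x : V, x ∈ ψ ↔ x = α ∨ x = -α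

/-- A pseudo-root system of dihedral type `I₂(m)`: `2m` equally spaced unit vectors in a plane.
For `m = 4` this is the type `B₂`. -/
def IsTypeI2 {V : Type*} [NormedAddCommGroup V] [InnerProductSpace ℝ V]
    (m : ℕ) (ψ : Finset V) : Prop :=
  ∃ u v : V, ‖u‖ = 1 ∧ ‖v‖ = 1 ∧ ⟪u, v⟫_ℝ = 0 ∧
    ∀ x : V, x ∈ ψ ↔ ∃ i : ℕ, i < 2 * m ∧
      x = Real.cos (i * Real.pi / m) • u + Real.sin (i * Real.pi / m) • v

/-- `φ` is a pseudo-root system of type `A₁ᵏ`, i.e. `{±f₁, …, ±f_k}` with `f₁, …, f_k`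
orthonormal. -/
def IsTypeA1Pow {V : Type*} [NormedAddCommGroup V] [InnerProductSpace ℝ V]
    (k : ℕ) (φ : Finset V) : Prop :=
  ∃ f : Fin k → V, Orthonormal ℝ f ∧ ∀ x : V, x ∈ φ ↔ ∃ i, x = f i ∨ x = -f i

open Classical in
/-- The positive part `φ⁺ = φ ∩ Φ⁺`. -/
def positivePart {V : Type*} [NormedAddCommGroup V] [InnerProductSpace ℝ V]
    (Φp φ : Finset V) : Finset V :=
  φ ∩ Φp

/-- `φ` is a `2`-structure for `Φ` (with positive system `Φp`). -/
structure IsTwoStructure {V : Type*} [NormedAddCommGroup V] [InnerProductSpace ℝ V]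
    (Φ Φp φ : Finset V) : Prop where
  subset : φ ⊆ Φ
  /-- `φ` is a disjoint union of pairwise orthogonal irreducible systems, each of type `A₁`,
  `B₂ = I₂(2²)` or `I₂(2ʲ)` with `j ≥ 3`. -/
  decomposition : ∃ (r : ℕ) (p : Fin r → Finset V),
    (∀ x, x ∈ φ ↔ ∃ i, x ∈ p i) ∧
    (∀ i j, i ≠ j → Disjoint (p i) (p j) ∧ ∀ x ∈ p i, ∀ y ∈ p j, ⟪x, y⟫_ℝ = 0) ∧
    ∀ i, IsTypeA1 (p i) ∨ ∃ j : ℕ, 2 ≤ j ∧ IsTypeI2 (2 ^ j) (p i)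
  /-- Every element of `W` that maps `φ⁺` onto itself has positive sign. -/
  sign_eq_one : ∀ w ∈ coxeterGroup Φ,
    w '' (positivePart Φp φ : Set V) = (positivePart Φp φ : Set V) → coxeterSign Φp w = 1

open Classical in
/-- The set `𝒯(Φ)` of `2`-structures for `Φ`. -/
def twoStructures {V : Type*} [NormedAddCommGroup V] [InnerProductSpace ℝ V]
    (Φ Φp : Finset V) : Finset (Finset V) :=
  Φ.powerset.filter fun φ => IsTwoStructure Φ Φp φ

/-- The sign `ε(φ)` of a `2`-structure `φ`:
`ε(φ) = (∑ (-1)^w over all w ∈ W with w(φ⁺) ⊆ Φ⁺) / #{w ∈ W | w(φ⁺) = φ⁺}`.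

This is the closed form of the usual sign. The usual sign takes values `±1` and is determined by
`ε(w(φ)) = (-1)^w ε(φ)` whenever `w ∈ W` and `w(φ⁺) ⊆ Φ⁺`, and `∑_{φ ∈ 𝒯(Φ)} ε(φ) = 1`: the map
`w ↦ w(φ)` from `{w ∈ W | w(φ⁺) ⊆ Φ⁺}` to `𝒯(Φ)` is surjective and its fibres are cosets of
`{w ∈ W | w(φ⁺) = φ⁺}`, so that the two properties give `1 = ε(φ) * (the quotient above)`.
The group `W` is finite, so the sum is a finite one. -/
def twoStructureSign {V : Type*} [NormedAddCommGroup V] [InnerProductSpace ℝ V]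
    (Φ Φp φ : Finset V) : ℝ :=
  (∑ᶠ w ∈ {w : V ≃ₗᵢ[ℝ] V | w ∈ coxeterGroup Φ ∧ ∀ x ∈ positivePart Φp φ, w x ∈ Φp},
      (coxeterSign Φp w : ℝ)) /
    (Nat.card {w : V ≃ₗᵢ[ℝ] V // w ∈ coxeterGroup Φ ∧
      w '' (positivePart Φp φ : Set V) = (positivePart Φp φ : Set V)} : ℝ)

/-- The coefficient `c_m = (-1)^m * binom((n - k)/2, m)`, with the generalized binomial coefficient
`binom(t, m) = t (t - 1) ⋯ (t - m + 1) / m!`. -/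
def taylorCoeff (n k m : ℕ) : ℝ :=
  (-1) ^ m * ((∏ i ∈ Finset.range m, (((n : ℝ) - (k : ℝ)) / 2 - (i : ℝ))) / (m.factorial : ℝ))

open Classical in
/-- The polynomial `T_d` in variables `x_s` indexed by a finite set `σ` with `k` elements; `n` is
the dimension of the ambient space. For `d = 2m + k` it is
`c_m ∑_{r_1 + ⋯ + r_k = m} multinomial(m; r_1, …, r_k) ∏ x_s^(2 r_s + 1) / (2 r_s + 1)`,
and it is zero if `d < k` or if `d` and `k` have opposite parity. -/
def taylorPoly (n d : ℕ) (σ : Type*) [Fintype σ] : MvPolynomial σ ℝ :=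
  if Fintype.card σ ≤ d ∧ Even (d - Fintype.card σ) then
    MvPolynomial.C (taylorCoeff n (Fintype.card σ) ((d - Fintype.card σ) / 2)) *
      ∑ r ∈ Finset.piAntidiag (Finset.univ : Finset σ) ((d - Fintype.card σ) / 2),
        MvPolynomial.C (Nat.multinomial Finset.univ r : ℝ) *
          ∏ s : σ, (MvPolynomial.C (1 / (2 * (r s : ℝ) + 1)) * MvPolynomial.X s ^ (2 * r s + 1))
  else 0

/-! Polynomials on `V` are written in the coordinates of a basis `b` of `V`. -/

/-- The value at the vector `a` of a polynomial written in the coordinates of the basis `b`. -/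
def evalAt {V : Type*} [NormedAddCommGroup V] [InnerProductSpace ℝ V]
    {ι : Type*} [Fintype ι] (b : Module.Basis ι ℝ V) (p : MvPolynomial ι ℝ) (a : V) : ℝ :=
  MvPolynomial.eval (fun i => b.repr a i) p

/-- The linear polynomial `a ↦ (f, a)`. -/
def pairing {V : Type*} [NormedAddCommGroup V] [InnerProductSpace ℝ V]
    {ι : Type*} [Fintype ι] (b : Module.Basis ι ℝ V) (f : V) : MvPolynomial ι ℝ :=
  ∑ i, MvPolynomial.C ⟪f, b i⟫_ℝ * MvPolynomial.X i

theorem evalAt_pairing {V : Type*} [NormedAddCommGroup V] [InnerProductSpace ℝ V]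
    {ι : Type*} [Fintype ι] (b : Module.Basis ι ℝ V) (f a : V) :
    evalAt b (pairing b f) a = ⟪f, a⟫_ℝ := by
  conv_rhs => rw [← b.sum_repr a, inner_sum]
  simp only [evalAt, pairing, map_sum, map_mul, MvPolynomial.eval_C, MvPolynomial.eval_X,
    inner_smul_right, mul_comm]

/-- The Jacobian `J(a) = ∏_{α ∈ Φ⁺} (α, a)`. -/
def jacobian {V : Type*} [NormedAddCommGroup V] [InnerProductSpace ℝ V]
    {ι : Type*} [Fintype ι] (b : Module.Basis ι ℝ V) (Φp : Finset V) : MvPolynomial ι ℝ :=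
  ∏ α ∈ Φp, pairing b α

/-- The polynomial `T_d(ψ; a) = T_d((f₁, a), …, (f_k, a))` for `ψ = {f₁, …, f_k} ⊆ V`. -/
def taylorOn {V : Type*} [NormedAddCommGroup V] [InnerProductSpace ℝ V]
    {ι : Type*} [Fintype ι] (b : Module.Basis ι ℝ V) (d : ℕ) (ψ : Finset V) : MvPolynomial ι ℝ :=
  MvPolynomial.aeval (fun f : ψ => pairing b (f : V)) (taylorPoly (Module.finrank ℝ V) d ψ)

/-- The polynomial `Z_d(Φ; a) = ∑_{φ ∈ 𝒯(Φ)} ε(φ) T_d(φ⁺; a)`. -/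
def zPoly {V : Type*} [NormedAddCommGroup V] [InnerProductSpace ℝ V]
    {ι : Type*} [Fintype ι] (b : Module.Basis ι ℝ V) (Φ Φp : Finset V) (d : ℕ) :
    MvPolynomial ι ℝ :=
  ∑ φ ∈ twoStructures Φ Φp,
    MvPolynomial.C (twoStructureSign Φ Φp φ) * taylorOn b d (positivePart Φp φ)

end CoxeterPizza

end

/-!
The sign `(-1)^w` is a character of `W` with value `-1` on every reflection. It is multiplicative
because `∏ (α, w(x)) = (-1)^w ∏ (α, x)` over the positive pseudo-roots (`prod_inner_apply`), and a
reflection has an odd number of inversions (`coxeterSign_rootReflection`).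

Skew-symmetry compares the summand of `φ` in `Z_d(w(a))` with the summand of `w⁻¹(φ)` in `Z_d(a)`
(`summand_apply`). Write `φ⁺ = {f₁, …, f_k}` and `w⁻¹(f_i) = ±g_i` with `g_i` positive. As `T_d` is
odd in each variable (`eval_taylorPoly_neg`), `T_d(φ⁺; w(a))` and `T_d(w⁻¹(φ)⁺; a)` differ by the
product of these signs. As the `g_i` are orthonormal, the reflections in those with a minus sign
correct `w⁻¹` to an element `u ∈ W` with `u(f_i) = g_i`, whose sign is `(-1)^w` times the same
product, and `ε(w⁻¹(φ)) = (-1)^u ε(φ)` directly from the formula for `ε` (`twoStructureSign_eq`).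
The products cancel, and only `(-1)^w` is left. That `W` acts transitively on the `2`-structures,
or that `ε` takes the values `±1`, is not needed.

By skew-symmetry under the reflection `s_α`, the polynomial `Z_d` vanishes on `H_α`, so the linear
form `(α, ·)` divides it (`pairing_dvd_iff`). The forms belonging to distinct positive pseudo-roots
are relatively prime, so their product divides `Z_d` too (`jacobian_dvd`).
-/

namespace CoxeterPizza

open scoped InnerProductSpace

/-! ### The sign character of the Coxeter group -/

section Sign

variable {V : Type*} [NormedAddCommGroup V] [InnerProductSpace ℝ V] {Φ Φp : Finset V} {v : V}

theorem rootReflection_apply {α : V} (hα : ‖α‖ = 1) (x : V) :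
    rootReflection α x = x - (2 * ⟪α, x⟫_ℝ) • α := by
  rw [rootReflection, Submodule.reflection_orthogonal_apply, Submodule.reflection_singleton_apply]
  simp [hα, two_smul, add_smul, two_mul]

theorem rootReflection_self (α : V) : rootReflection α α = -α :=
  Submodule.reflection_orthogonalComplement_singleton_eq_neg α

theorem rootReflection_rootReflection (α x : V) :
    rootReflection α (rootReflection α x) = x :=
  Submodule.reflection_reflection _ x

theorem rootReflection_mem_coxeterGroup {α : V} (hα : α ∈ Φ) :
    rootReflection α ∈ coxeterGroup Φ :=
  Subgroup.subset_closure ⟨α, hα, rfl⟩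

theorem IsPseudoRootSystem.neg_mem (hΦ : IsPseudoRootSystem Φ) {α : V} (hα : α ∈ Φ) :
    -α ∈ Φ :=
  rootReflection_self α ▸ hΦ.reflection_mem α hα α hα

theorem IsPseudoRootSystem.apply_mem (hΦ : IsPseudoRootSystem Φ) {w : V ≃ₗᵢ[ℝ] V}
    (hw : w ∈ coxeterGroup Φ) : ∀ {α : V}, α ∈ Φ → w α ∈ Φ := by
  induction hw using Subgroup.closure_induction'' with
  | mem s hs =>
    obtain ⟨β, hβ, rfl⟩ := hs
    exact fun {α} hα => hΦ.reflection_mem α hα β hβ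
  | inv_mem s hs =>
    obtain ⟨β, hβ, rfl⟩ := hs
    have h : (rootReflection β)⁻¹ = rootReflection β := Submodule.reflection_symm
    exact fun {α} hα => h ▸ hΦ.reflection_mem α hα β hβ
  | one => exact fun hα => hα
  | mul x y _ _ hx hy => exact fun hα => hx (hy hα)

theorem inner_inv_apply (w : V ≃ₗᵢ[ℝ] V) (α x : V) : ⟪w⁻¹ α, x⟫_ℝ = ⟪α, w x⟫_ℝ := by
  rw [← w.inner_map_map (w⁻¹ α) x]
  exact congrArg (⟪·, w x⟫_ℝ) (w.apply_symm_apply α)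

/-- `v` is a regular vector whose open half-space cuts the positive system `Φp` out of `Φ`. -/
def IsChamberVector (Φ Φp : Finset V) (v : V) : Prop :=
  (∀ α ∈ Φ, ⟪α, v⟫_ℝ ≠ 0) ∧ ∀ α : V, α ∈ Φp ↔ α ∈ Φ ∧ 0 < ⟪α, v⟫_ℝ

theorem IsChamberVector.mem_or_neg_mem (hv : IsChamberVector Φ Φp v) (hΦ : IsPseudoRootSystem Φ)
    {α : V} (hα : α ∈ Φ) : α ∈ Φp ∨ -α ∈ Φp := by
  rw [hv.2, hv.2, inner_neg_left]
  rcases lt_or_gt_of_ne (hv.1 α hα) with h | h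
  · exact Or.inr ⟨hΦ.neg_mem hα, by linarith⟩
  · exact Or.inl ⟨hα, h⟩

theorem IsChamberVector.neg_notMem (hv : IsChamberVector Φ Φp v) {α : V} (hα : α ∈ Φp) :
    -α ∉ Φp := by
  rw [hv.2, inner_neg_left]
  rw [hv.2] at hα
  intro h
  linarith [h.2, hα.2]

theorem IsChamberVector.neg_mem_iff (hv : IsChamberVector Φ Φp v) (hΦ : IsPseudoRootSystem Φ)
    {α : V} (hα : α ∈ Φ) : -α ∈ Φp ↔ α ∉ Φp :=
  ⟨fun h h' => hv.neg_notMem h' h, (hv.mem_or_neg_mem hΦ hα).resolve_left⟩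

open Classical in
/-- The hyperplane `H_α` separates `w(T₀)` from `T₀` exactly when `w⁻¹(α)` is a negative
pseudo-root, so that `(-1)^w` counts the inversions of `w⁻¹`. -/
theorem coxeterSign_eq (hΦ : IsPseudoRootSystem Φ) (hv : IsChamberVector Φ Φp v)
    {w : V ≃ₗᵢ[ℝ] V} (hw : w ∈ coxeterGroup Φ) :
    coxeterSign Φp w = (-1) ^ (Φp.filter fun α => w⁻¹ α ∉ Φp).card := by
  rw [coxeterSign]
  congr 2
  refine Finset.filter_congr fun α hα => ?_
  have hwα : w⁻¹ α ∈ Φ := hΦ.apply_mem (inv_mem hw) ((hv.2 α).1 hα).1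
  simp only [← inner_inv_apply]
  constructor
  · intro h hp
    exact (h v fun β hβ => ((hv.2 β).1 hβ).2.le).not_gt ((hv.2 _).1 hp).2
  · intro h x hx
    simpa using hx _ ((hv.neg_mem_iff hΦ hwα).2 h)

open Classical in
/-- The product `∏ (α, x)` over the positive pseudo-roots changes by the factor `(-1)^w` under
`w`: the pseudo-roots `w⁻¹(α)` are again the positive ones up to sign, and the signs are those
counted by `(-1)^w`. -/
theorem prod_inner_apply (hΦ : IsPseudoRootSystem Φ) (hv : IsChamberVector Φ Φp v)
    {w : V ≃ₗᵢ[ℝ] V} (hw : w ∈ coxeterGroup Φ) (x : V) :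
    ∏ α ∈ Φp, ⟪α, w x⟫_ℝ = (coxeterSign Φp w : ℝ) * ∏ α ∈ Φp, ⟪α, x⟫_ℝ := by
  have hpos : ∀ u ∈ coxeterGroup Φ, ∀ α ∈ Φp, (if u α ∈ Φp then u α else -u α) ∈ Φp := by
    intro u hu α hα
    have := hΦ.apply_mem hu ((hv.2 α).1 hα).1
    split_ifs with h
    · exact h
    · exact (hv.neg_mem_iff hΦ this).2 h
  have hcancel : ∀ u : V ≃ₗᵢ[ℝ] V, ∀ α ∈ Φp,
      (if u⁻¹ (if u α ∈ Φp then u α else -u α) ∈ Φp then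
        u⁻¹ (if u α ∈ Φp then u α else -u α) else -u⁻¹ (if u α ∈ Φp then u α else -u α)) = α := by
    intro u α hα
    by_cases h : u α ∈ Φp
    · simp [h, hα]
    · simp [h, hv.neg_notMem hα]
  have key : ∏ α ∈ Φp, ⟪(if w⁻¹ α ∈ Φp then w⁻¹ α else -w⁻¹ α), x⟫_ℝ = ∏ α ∈ Φp, ⟪α, x⟫_ℝ :=
    Finset.prod_nbij' (fun α => if w⁻¹ α ∈ Φp then w⁻¹ α else -w⁻¹ α)
      (fun α => if w α ∈ Φp then w α else -w α) (hpos _ (inv_mem hw)) (hpos _ hw)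
      (fun α hα => by simpa using hcancel w⁻¹ α hα) (hcancel w) (fun _ _ => rfl)
  rw [coxeterSign_eq hΦ hv hw, ← key]
  push_cast
  rw [← Finset.prod_const, Finset.prod_filter, ← Finset.prod_mul_distrib]
  refine Finset.prod_congr rfl fun α _ => ?_
  rw [← inner_inv_apply]
  by_cases h : w⁻¹ α ∈ Φp
  · rw [if_neg (not_not.2 h), if_pos h, one_mul]
  · rw [if_pos h, if_neg h, inner_neg_left, neg_one_mul, neg_neg]

theorem coxeterSign_mul (hΦ : IsPseudoRootSystem Φ) (hv : IsChamberVector Φ Φp v)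
    {w u : V ≃ₗᵢ[ℝ] V} (hw : w ∈ coxeterGroup Φ) (hu : u ∈ coxeterGroup Φ) :
    coxeterSign Φp (w * u) = coxeterSign Φp w * coxeterSign Φp u := by
  have hne : ∏ α ∈ Φp, ⟪α, v⟫_ℝ ≠ 0 :=
    Finset.prod_ne_zero_iff.2 fun α hα => ((hv.2 α).1 hα).2.ne'
  have h1 := prod_inner_apply hΦ hv (mul_mem hw hu) v
  rw [LinearIsometryEquiv.coe_mul, Function.comp_apply, prod_inner_apply hΦ hv hw,
    prod_inner_apply hΦ hv hu,
    ← mul_assoc] at h1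
  exact_mod_cast (mul_right_cancel₀ hne h1).symm

theorem coxeterSign_mul_self (Φp : Finset V) (w : V ≃ₗᵢ[ℝ] V) :
    coxeterSign Φp w * coxeterSign Φp w = 1 := by
  rw [coxeterSign, ← mul_pow]
  simp

theorem coxeterSign_one (hΦ : IsPseudoRootSystem Φ) (hv : IsChamberVector Φ Φp v) :
    coxeterSign Φp (1 : V ≃ₗᵢ[ℝ] V) = 1 := by
  have h := coxeterSign_mul hΦ hv (one_mem (coxeterGroup Φ)) (one_mem _)
  rw [mul_one, coxeterSign_mul_self] at h
  exact h

theorem coxeterSign_inv (hΦ : IsPseudoRootSystem Φ) (hv : IsChamberVector Φ Φp v)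
    {w : V ≃ₗᵢ[ℝ] V} (hw : w ∈ coxeterGroup Φ) :
    coxeterSign Φp w⁻¹ = coxeterSign Φp w := by
  have h := coxeterSign_mul hΦ hv (inv_mem hw) hw
  rw [inv_mul_cancel, coxeterSign_one hΦ hv] at h
  calc coxeterSign Φp w⁻¹ = coxeterSign Φp w⁻¹ * (coxeterSign Φp w * coxeterSign Φp w) := by
        rw [coxeterSign_mul_self, mul_one]
    _ = coxeterSign Φp w := by rw [← mul_assoc, ← h, one_mul]

open Classical in
/-- The map `α ↦ -s_β(α)` is an involution of the inversions of `s_β`, and `β` is its only fixed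
point, so the number of inversions is odd. -/
theorem coxeterSign_rootReflection (hΦ : IsPseudoRootSystem Φ) (hv : IsChamberVector Φ Φp v)
    {β : V} (hβ : β ∈ Φ) : coxeterSign Φp (rootReflection β) = -1 := by
  wlog hβp : β ∈ Φp generalizing β with H
  · have h := H (hΦ.neg_mem hβ) ((hv.neg_mem_iff hΦ hβ).2 hβp)
    have hneg : rootReflection (-β) = rootReflection β := by
      have hβ1 := hΦ.norm_eq_one β hβ
      ext x
      rw [rootReflection_apply hβ1, rootReflection_apply ((norm_neg β).trans hβ1)]
      simp
    rwa [hneg] at h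
  have hinv : (rootReflection β)⁻¹ = rootReflection β := Submodule.reflection_symm
  rw [coxeterSign_eq hΦ hv (rootReflection_mem_coxeterGroup hβ), hinv]
  set S := Φp.filter fun α => rootReflection β α ∉ Φp with hS
  have hβS : β ∈ S := by
    rw [hS, Finset.mem_filter, rootReflection_self]
    exact ⟨hβp, hv.neg_notMem hβp⟩
  rw [← Finset.prod_const, ← Finset.mul_prod_erase _ _ hβS]
  have hone : ∏ _α ∈ S.erase β, (-1 : ℤ) = 1 := by
    refine Finset.prod_involution (fun α _ => -rootReflection β α) (fun _ _ => by norm_num)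
      ?_ ?_ (fun α _ => by simp [rootReflection_rootReflection])
    · rintro α hα - hfix
      rw [Finset.mem_erase, hS, Finset.mem_filter] at hα
      obtain ⟨hne, hαp, -⟩ := hα
      have hα1 := hΦ.norm_eq_one α ((hv.2 α).1 hαp).1
      have hβ1 := hΦ.norm_eq_one β hβ
      rw [rootReflection_apply hβ1] at hfix
      -- a fixed point is a multiple of `β`, of norm one and positive like `β`
      have hmul : α = ⟪β, α⟫_ℝ • β := by
        have h2 : (2 : ℝ) • α = (2 : ℝ) • (⟪β, α⟫_ℝ • β) := by
          rw [two_smul, smul_smul]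
          nth_rewrite 1 [← hfix]
          abel
        exact smul_right_injective V (two_ne_zero) h2
      have habs : |⟪β, α⟫_ℝ| = 1 := by
        have := congrArg norm hmul
        rw [norm_smul, hα1, hβ1, mul_one, Real.norm_eq_abs] at this
        exact this.symm
      rcases eq_or_eq_neg_of_abs_eq habs with h | h
      · rw [h, one_smul] at hmul
        exact hne hmul
      · rw [h, neg_one_smul] at hmul
        exact hv.neg_notMem hβp (hmul ▸ hαp)
    · intro α hα
      rw [Finset.mem_erase, hS, Finset.mem_filter] at hα
      obtain ⟨hne, hαp, hα'⟩ := hα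
      have hsα := hΦ.reflection_mem α ((hv.2 α).1 hαp).1 β hβ
      rw [Finset.mem_erase, hS, Finset.mem_filter, map_neg, rootReflection_rootReflection]
      refine ⟨fun h => hne ?_, (hv.neg_mem_iff hΦ hsα).2 hα', hv.neg_notMem hαp⟩
      rw [← rootReflection_rootReflection β α, neg_eq_iff_eq_neg.1 h, map_neg,
        rootReflection_self, neg_neg]
  rw [hone, mul_one]

end Sign

/-! ### Parity and reindexing of the Taylor polynomial -/

theorem eval_taylorPoly (n d : ℕ) {σ : Type*} [Fintype σ] [DecidableEq σ] (x : σ → ℝ) :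
    MvPolynomial.eval x (taylorPoly n d σ) =
      if Fintype.card σ ≤ d ∧ Even (d - Fintype.card σ) then
        taylorCoeff n (Fintype.card σ) ((d - Fintype.card σ) / 2) *
          ∑ r ∈ Finset.piAntidiag (Finset.univ : Finset σ) ((d - Fintype.card σ) / 2),
            (Nat.multinomial Finset.univ r : ℝ) *
              ∏ s : σ, (1 / (2 * (r s : ℝ) + 1) * x s ^ (2 * r s + 1))
      else 0 := by
  rw [taylorPoly]
  split_ifs
  · simp only [map_mul, map_sum, map_prod, map_pow, MvPolynomial.eval_C, MvPolynomial.eval_X]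
    congr!
  · simp

theorem eval_taylorPoly_comp_equiv (n d : ℕ) {σ τ : Type*} [Fintype σ] [Fintype τ] (e : σ ≃ τ)
    (x : τ → ℝ) :
    MvPolynomial.eval (x ∘ e) (taylorPoly n d σ) = MvPolynomial.eval x (taylorPoly n d τ) := by
  classical
  rw [eval_taylorPoly, eval_taylorPoly, Fintype.card_congr e]
  refine if_congr Iff.rfl (congrArg _ ?_) rfl
  refine Finset.sum_nbij' (fun r => r ∘ e.symm) (fun r => r ∘ e) ?_ ?_ ?_ ?_ ?_
  · intro r hr
    simp only [Finset.mem_piAntidiag, Finset.mem_univ, implies_true, and_true] at hr ⊢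
    rw [← hr]
    exact e.symm.sum_comp r
  · intro r hr
    simp only [Finset.mem_piAntidiag, Finset.mem_univ, implies_true, and_true] at hr ⊢
    rw [← hr]
    exact e.sum_comp r
  · intro r _
    ext; simp
  · intro r _
    ext; simp
  · intro r _
    congr 1
    · have h1 : ∑ i, (r ∘ e.symm) i = ∑ i, r i := e.symm.sum_comp r
      have h2 : ∏ i, ((r ∘ e.symm) i).factorial = ∏ i, (r i).factorial :=
        e.symm.prod_comp fun i => (r i).factorial
      rw [Nat.multinomial, Nat.multinomial, h1, h2]
    · rw [← e.prod_comp]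
      simp

/-- `T_d` is odd in each of its variables. -/
theorem eval_taylorPoly_neg (n d : ℕ) {σ : Type*} [Fintype σ] [DecidableEq σ] (s : Finset σ)
    (x : σ → ℝ) :
    MvPolynomial.eval (fun i => if i ∈ s then -x i else x i) (taylorPoly n d σ) =
      (-1) ^ s.card * MvPolynomial.eval x (taylorPoly n d σ) := by
  rw [eval_taylorPoly, eval_taylorPoly, mul_ite, mul_zero]
  refine if_congr Iff.rfl ?_ rfl
  rw [mul_left_comm]
  refine congrArg _ ?_
  rw [Finset.mul_sum]
  refine Finset.sum_congr rfl fun r _ => ?_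
  have hsign : ((-1 : ℝ)) ^ s.card = ∏ i, if i ∈ s then -1 else 1 := by
    rw [Finset.prod_ite_mem, Finset.univ_inter, Finset.prod_const]
  rw [mul_left_comm, hsign, ← Finset.prod_mul_distrib]
  congr 1
  refine Finset.prod_congr rfl fun i _ => ?_
  split_ifs
  · rw [Odd.neg_pow ⟨r i, rfl⟩]
    ring
  · rw [one_mul]

/-! ### Divisibility by linear forms -/

section Divisibility

variable {V : Type*} [NormedAddCommGroup V] [InnerProductSpace ℝ V] {ι : Type*} [Fintype ι]

theorem exists_coord (b : Module.Basis ι ℝ V) (y : ι → ℝ) :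
    ∃ a : V, (fun i => b.repr a i) = y :=
  ⟨b.equivFun.symm y, b.equivFun.apply_symm_apply y⟩

theorem evalAt_mul (b : Module.Basis ι ℝ V) (p q : MvPolynomial ι ℝ) (a : V) :
    evalAt b (p * q) a = evalAt b p a * evalAt b q a :=
  map_mul _ p q

/-- Writing `(α, ·)` in coordinates, some coordinate `X_j` has a nonzero coefficient `c`. The
substitution `X_j ↦ X_j - (α, ·)/c` changes no polynomial modulo `(α, ·)`, and it turns a
polynomial vanishing on `H_α` into zero. -/
theorem exists_restriction (b : Module.Basis ι ℝ V) {α : V} (hα : α ≠ 0) :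
    ∃ ρ : MvPolynomial ι ℝ →ₐ[ℝ] MvPolynomial ι ℝ,
      (∀ p, ρ p = 0 → pairing b α ∣ p) ∧
        ∀ p, (∀ a : V, ⟪α, a⟫_ℝ = 0 → evalAt b p a = 0) → ρ p = 0 := by
  classical
  obtain ⟨j, hj⟩ : ∃ j, ⟪α, b j⟫_ℝ ≠ 0 := by
    by_contra! hall
    refine hα (inner_self_eq_zero (𝕜 := ℝ).1 ?_)
    rw [← evalAt_pairing b α α]
    simp [evalAt, pairing, hall]
  set L := pairing b α with hL
  set g : ι → MvPolynomial ι ℝ :=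
    fun i => MvPolynomial.X i - if i = j then MvPolynomial.C (⟪α, b j⟫_ℝ)⁻¹ * L else 0 with hg
  refine ⟨MvPolynomial.aeval g, fun p hp => ?_, fun p h => ?_⟩
  · have hmod : (Ideal.Quotient.mkₐ ℝ (Ideal.span {L})).comp (MvPolynomial.aeval g) =
        Ideal.Quotient.mkₐ ℝ (Ideal.span {L}) := by
      refine MvPolynomial.algHom_ext fun i => ?_
      rw [AlgHom.comp_apply, MvPolynomial.aeval_X, Ideal.Quotient.mkₐ_eq_mk, Ideal.Quotient.eq, hg,
        sub_sub_cancel_left, neg_mem_iff]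
      split_ifs
      · exact Ideal.mul_mem_left _ _ (Ideal.mem_span_singleton_self L)
      · exact zero_mem _
    have h0 := congrArg (fun f => f p) hmod
    simp only [AlgHom.comp_apply, hp, map_zero] at h0
    rw [← Ideal.mem_span_singleton, ← Ideal.Quotient.eq_zero_iff_mem]
    exact h0.symm
  · refine MvPolynomial.funext fun y => ?_
    obtain ⟨a, rfl⟩ := exists_coord b y
    rw [map_zero, MvPolynomial.map_aeval]
    have hpt : (fun i => MvPolynomial.eval (fun i => b.repr a i) (g i)) =
        fun i => b.repr (a - ((⟪α, b j⟫_ℝ)⁻¹ * ⟪α, a⟫_ℝ) • b j) i := by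
      ext i
      have hLa : MvPolynomial.eval (fun i => b.repr a i) L = ⟪α, a⟫_ℝ := evalAt_pairing b α a
      simp only [hg, map_sub, MvPolynomial.eval_X, map_smul, Finsupp.sub_apply, Finsupp.smul_apply,
        b.repr_self, Finsupp.single_apply, smul_eq_mul]
      by_cases hij : i = j
      · simp [hij, hLa]
      · simp [hij, Ne.symm hij]
    have hcomp : (MvPolynomial.eval fun i => b.repr a i).comp
        (algebraMap ℝ (MvPolynomial ι ℝ)) = RingHom.id ℝ := by
      ext; simp
    rw [hpt, hcomp]
    refine h _ ?_
    rw [inner_sub_right, inner_smul_right]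
    field_simp
    ring

theorem pairing_dvd_iff (b : Module.Basis ι ℝ V) {α : V} (hα : α ≠ 0) (p : MvPolynomial ι ℝ) :
    pairing b α ∣ p ↔ ∀ a : V, ⟪α, a⟫_ℝ = 0 → evalAt b p a = 0 := by
  constructor
  · rintro ⟨q, rfl⟩ a ha
    rw [evalAt_mul, evalAt_pairing, ha, zero_mul]
  · obtain ⟨ρ, h1, h2⟩ := exists_restriction b hα
    exact fun h => h1 p (h2 p h)

theorem prime_pairing (b : Module.Basis ι ℝ V) {α : V} (hα : α ≠ 0) : Prime (pairing b α) := by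
  obtain ⟨ρ, h1, h2⟩ := exists_restriction b hα
  have hρ : ∀ p, pairing b α ∣ p → ρ p = 0 := fun p hp => h2 p ((pairing_dvd_iff b hα p).1 hp)
  refine ⟨fun h0 => ?_, fun hu => ?_, fun p q hpq => ?_⟩
  · have := evalAt_pairing b α α
    rw [h0, evalAt, map_zero] at this
    exact hα (inner_self_eq_zero.1 this.symm)
  · exact one_ne_zero ((map_one ρ).symm.trans (hρ 1 hu.dvd))
  · have := hρ _ hpq
    rw [map_mul, mul_eq_zero] at this
    exact this.imp (h1 p) (h1 q)

theorem isRelPrime_pairing (b : Module.Basis ι ℝ V) {α β : V} (hα : α ≠ 0)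
    (hαβ : β ∉ Submodule.span ℝ {α}) : IsRelPrime (pairing b α) (pairing b β) := by
  rw [(prime_pairing b hα).irreducible.isRelPrime_iff_not_dvd, pairing_dvd_iff b hα]
  intro h
  refine hαβ ?_
  rw [← Submodule.orthogonal_orthogonal (Submodule.span ℝ {α}), Submodule.mem_orthogonal']
  intro a ha
  rw [← evalAt_pairing b]
  exact h a (Submodule.mem_orthogonal_singleton_iff_inner_right.1 ha)

end Divisibility

/-! ### Skew-symmetry -/

section SkewSymmetry

variable {V : Type*} [NormedAddCommGroup V] [InnerProductSpace ℝ V] {Φ Φp : Finset V} {v : V}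
  {k : ℕ}

/-- `f` is an orthonormal enumeration of the positive part of the system `φ = {±f₁, …, ±f_k}` of
type `A₁ᵏ`. -/
structure IsPositiveFrame (Φp φ : Finset V) (f : Fin k → V) : Prop where
  orthonormal : Orthonormal ℝ f
  mem (i : Fin k) : f i ∈ Φp
  mem_iff (x : V) : x ∈ φ ↔ ∃ i, x = f i ∨ x = -f i

theorem Orthonormal.ite_neg {f : Fin k → V} (hf : Orthonormal ℝ f) (s : Finset (Fin k)) :
    Orthonormal ℝ fun i => if i ∈ s then -f i else f i := by
  constructor
  · intro i
    dsimp only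
    split_ifs
    · rw [norm_neg, hf.1 i]
    · exact hf.1 i
  · intro i j hij
    have := hf.2 hij
    dsimp only
    split_ifs <;> simp [this]

/-- Changing signs turns an orthonormal family of pseudo-roots into a positive one. -/
theorem exists_isPositiveFrame (hΦ : IsPseudoRootSystem Φ) (hv : IsChamberVector Φ Φp v)
    {φ : Finset V} {h : Fin k → V} (hh : Orthonormal ℝ h)
    (hφ : ∀ x, x ∈ φ ↔ ∃ i, x = h i ∨ x = -h i) (hsub : ∀ i, h i ∈ Φ) :
    ∃ s : Finset (Fin k), IsPositiveFrame Φp φ fun i => if i ∈ s then -h i else h i := by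
  classical
  refine ⟨Finset.univ.filter fun i => h i ∉ Φp, Orthonormal.ite_neg hh _, fun i => ?_, fun x => ?_⟩
  · by_cases hi : h i ∈ Φp
    · simp [hi]
    · simpa [hi] using (hv.neg_mem_iff hΦ (hsub i)).2 hi
  · rw [hφ]
    refine exists_congr fun i => ?_
    by_cases hi : h i ∈ Φp
    · simp [hi]
    · simp [hi, or_comm]

theorem IsPositiveFrame.coe_positivePart {φ : Finset V} {f : Fin k → V}
    (hf : IsPositiveFrame Φp φ f) (hv : IsChamberVector Φ Φp v) :
    (positivePart Φp φ : Set V) = Set.range f := by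
  classical
  ext x
  rw [positivePart, Finset.mem_coe, Finset.mem_inter, hf.mem_iff]
  constructor
  · rintro ⟨⟨i, rfl | rfl⟩, hx⟩
    · exact ⟨i, rfl⟩
    · exact absurd hx (hv.neg_notMem (hf.mem i))
  · rintro ⟨i, rfl⟩
    exact ⟨⟨i, Or.inl rfl⟩, hf.mem i⟩

theorem IsPositiveFrame.evalAt_taylorOn {φ : Finset V} {f : Fin k → V}
    (hf : IsPositiveFrame Φp φ f) (hv : IsChamberVector Φ Φp v) {ι : Type*} [Fintype ι]
    (b : Module.Basis ι ℝ V) (d : ℕ) (a : V) :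
    evalAt b (taylorOn b d (positivePart Φp φ)) a =
      MvPolynomial.eval (fun i => ⟪f i, a⟫_ℝ) (taylorPoly (Module.finrank ℝ V) d (Fin k)) := by
  have hc := hf.coe_positivePart hv
  let e : Fin k ≃ positivePart Φp φ :=
    (Equiv.ofInjective f hf.orthonormal.linearIndependent.injective).trans
      (Equiv.setCongr hc.symm)
  have he : ∀ i, (e i : V) = f i := fun _ => rfl
  have hcomp : (MvPolynomial.eval fun i => b.repr a i).comp
      (algebraMap ℝ (MvPolynomial ι ℝ)) = RingHom.id ℝ := by
    ext; simp
  rw [evalAt, taylorOn, MvPolynomial.map_aeval, hcomp]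
  have hpt : (fun g : positivePart Φp φ =>
      MvPolynomial.eval (fun i => b.repr a i) (pairing b (g : V))) =
        fun g : positivePart Φp φ => ⟪(g : V), a⟫_ℝ :=
    funext fun g => evalAt_pairing b g a
  rw [hpt]
  exact (eval_taylorPoly_comp_equiv _ d e fun g : positivePart Φp φ => ⟪(g : V), a⟫_ℝ).symm

/-- Reflections in orthogonal pseudo-roots change signs independently of each other. -/
theorem exists_sign_change (hΦ : IsPseudoRootSystem Φ) (hv : IsChamberVector Φ Φp v)
    {h : Fin k → V} (hh : Orthonormal ℝ h) (hsub : ∀ i, h i ∈ Φ) (s : Finset (Fin k)) :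
    ∃ r ∈ coxeterGroup Φ, coxeterSign Φp r = (-1) ^ s.card ∧
      ∀ i, r (h i) = if i ∈ s then -h i else h i := by
  induction s using Finset.induction_on with
  | empty => exact ⟨1, one_mem _, by simpa using coxeterSign_one hΦ hv, by simp⟩
  | insert j s hj ih =>
    obtain ⟨r, hr, hsign, hact⟩ := ih
    have hs := rootReflection_mem_coxeterGroup (hsub j)
    refine ⟨r * rootReflection (h j), mul_mem hr hs, ?_, fun i => ?_⟩
    · rw [coxeterSign_mul hΦ hv hr hs, hsign, coxeterSign_rootReflection hΦ hv (hsub j),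
        Finset.card_insert_of_notMem hj, pow_succ]
    · rw [LinearIsometryEquiv.coe_mul, Function.comp_apply]
      by_cases hij : i = j
      · subst hij
        rw [rootReflection_self, map_neg, hact, if_neg hj, if_pos (Finset.mem_insert_self i s)]
      · rw [rootReflection_apply (hh.1 j), hh.2 (Ne.symm hij)]
        simp [hact, hij]

/-- If `u ∈ W` maps `φ⁺` onto `ψ⁺`, then `ε(ψ) = (-1)^u ε(φ)`: right translation by `u` matches
the two sums, and conjugation by `u` the two stabilizers. -/
theorem twoStructureSign_eq (hΦ : IsPseudoRootSystem Φ) (hv : IsChamberVector Φ Φp v)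
    {φ ψ : Finset V} {u : V ≃ₗᵢ[ℝ] V} (hu : u ∈ coxeterGroup Φ)
    (himg : u '' (positivePart Φp φ : Set V) = (positivePart Φp ψ : Set V)) :
    twoStructureSign Φ Φp ψ = (coxeterSign Φp u : ℝ) * twoStructureSign Φ Φp φ := by
  have himg' : ⇑u⁻¹ '' (positivePart Φp ψ : Set V) = (positivePart Φp φ : Set V) := by
    rw [← himg, Set.image_image]
    simp
  have hmem : ∀ x ∈ positivePart Φp φ, u x ∈ positivePart Φp ψ := fun x hx =>
    Finset.mem_coe.1 (himg ▸ Set.mem_image_of_mem u hx)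
  have hmem' : ∀ x ∈ positivePart Φp ψ, u⁻¹ x ∈ positivePart Φp φ := fun x hx =>
    Finset.mem_coe.1 (himg' ▸ Set.mem_image_of_mem _ hx)
  have hcard : Nat.card {w : V ≃ₗᵢ[ℝ] V // w ∈ coxeterGroup Φ ∧
        w '' (positivePart Φp ψ : Set V) = (positivePart Φp ψ : Set V)} =
      Nat.card {w : V ≃ₗᵢ[ℝ] V // w ∈ coxeterGroup Φ ∧
        w '' (positivePart Φp φ : Set V) = (positivePart Φp φ : Set V)} := by
    refine (Nat.card_congr ((MulAut.conj u).toEquiv.subtypeEquiv fun w => ?_)).symm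
    rw [MulEquiv.toEquiv_eq_coe, MulEquiv.coe_toEquiv, MulAut.conj_apply]
    refine and_congr ?_ ?_
    · rw [Subgroup.mul_mem_cancel_right _ (inv_mem hu), Subgroup.mul_mem_cancel_left _ hu]
    · rw [LinearIsometryEquiv.coe_mul, LinearIsometryEquiv.coe_mul, Set.image_comp, Set.image_comp,
        himg', ← himg, u.injective.image_injective.eq_iff]
  have hsum : (∑ᶠ w ∈ {w : V ≃ₗᵢ[ℝ] V | w ∈ coxeterGroup Φ ∧ ∀ x ∈ positivePart Φp ψ, w x ∈ Φp},
        (coxeterSign Φp w : ℝ)) =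
      (coxeterSign Φp u : ℝ) *
        ∑ᶠ w ∈ {w : V ≃ₗᵢ[ℝ] V | w ∈ coxeterGroup Φ ∧ ∀ x ∈ positivePart Φp φ, w x ∈ Φp},
          (coxeterSign Φp w : ℝ) := by
    rw [← smul_eq_mul, smul_finsum]
    simp_rw [smul_finsum, smul_eq_mul]
    refine finsum_mem_eq_of_bijOn (fun w => w * u) ⟨?_, ?_, ?_⟩ ?_
    · rintro w ⟨hw, hwp⟩
      exact ⟨mul_mem hw hu, fun x hx => hwp _ (hmem x hx)⟩
    · exact (mul_left_injective u).injOn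
    · rintro w ⟨hw, hwp⟩
      exact ⟨w * u⁻¹, ⟨mul_mem hw (inv_mem hu), fun x hx => hwp _ (hmem' x hx)⟩,
        inv_mul_cancel_right w u⟩
    · rintro w ⟨hw, -⟩
      rw [coxeterSign_mul hΦ hv hw hu]
      have := coxeterSign_mul_self Φp u
      rw [mul_comm (coxeterSign Φp w), ← Int.cast_mul, ← mul_assoc, this, one_mul]
  rw [twoStructureSign, twoStructureSign, hcard, hsum, mul_div_assoc]

/-- Being a `2`-structure of type `A₁ᵏ` is preserved by elements of `W` that preserve positive
parts. -/
theorem IsTwoStructure.of_image (hΦ : IsPseudoRootSystem Φ) (hv : IsChamberVector Φ Φp v)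
    {φ ψ : Finset V} {u : V ≃ₗᵢ[ℝ] V} (hu : u ∈ coxeterGroup Φ)
    (himg : u '' (positivePart Φp φ : Set V) = (positivePart Φp ψ : Set V))
    (hφ : IsTwoStructure Φ Φp φ) {g : Fin k → V} (hg : IsPositiveFrame Φp ψ g) :
    IsTwoStructure Φ Φp ψ := by
  classical
  refine ⟨fun x hx => ?_, ⟨k, fun i => {g i, -g i}, fun x => ?_, fun i j hij => ?_, fun i => ?_⟩,
    fun w hw hwψ => ?_⟩
  · obtain ⟨i, rfl | rfl⟩ := (hg.mem_iff x).1 hx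
    · exact ((hv.2 _).1 (hg.mem i)).1
    · exact hΦ.neg_mem ((hv.2 _).1 (hg.mem i)).1
  · simpa using hg.mem_iff x
  · have horth : ∀ x ∈ ({g i, -g i} : Finset V), ∀ y ∈ ({g j, -g j} : Finset V),
        ⟪x, y⟫_ℝ = 0 := by
      have := hg.orthonormal.2 hij
      intro x hx y hy
      simp only [Finset.mem_insert, Finset.mem_singleton] at hx hy
      rcases hx with rfl | rfl <;> rcases hy with rfl | rfl <;> simp [this]
    refine ⟨Finset.disjoint_left.2 fun x hx hx' => ?_, horth⟩
    have hx0 : x = 0 := inner_self_eq_zero.1 (horth x hx x hx')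
    have hg0 : g i ≠ 0 := hg.orthonormal.ne_zero i
    simp only [Finset.mem_insert, Finset.mem_singleton, hx0] at hx
    rcases hx with h | h
    · exact hg0 h.symm
    · exact hg0 (neg_eq_zero.1 h.symm)
  · exact Or.inl ⟨g i, hg.orthonormal.1 i, by simp⟩
  · have himg' : ⇑u⁻¹ '' (positivePart Φp ψ : Set V) = (positivePart Φp φ : Set V) := by
      rw [← himg, Set.image_image]
      simp
    have hwu := mul_mem (inv_mem hu) (mul_mem hw hu)
    have h1 := hφ.sign_eq_one (u⁻¹ * (w * u)) hwu (by
      rw [LinearIsometryEquiv.coe_mul, LinearIsometryEquiv.coe_mul, Set.image_comp, Set.image_comp,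
        himg, hwψ, himg'])
    rwa [coxeterSign_mul hΦ hv (inv_mem hu) (mul_mem hw hu), coxeterSign_mul hΦ hv hw hu,
      coxeterSign_inv hΦ hv hu, mul_left_comm, coxeterSign_mul_self, mul_one] at h1

open Classical in
/-- The summand of `φ` in `Z_d(w(a))` is `(-1)^w` times the summand of `w⁻¹(φ)` in `Z_d(a)`. If
`w⁻¹(f_i) = ±g_i` with `g_i` positive, then the minus signs occur in `T_d(φ⁺; w(a))` because `T_d`
is odd in each variable. They occur also in `ε(w⁻¹(φ))`, because the element of `W` taking `f_i` to
`g_i` is `w⁻¹` followed by the reflections in those `g_i`. -/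
theorem summand_apply (hΦ : IsPseudoRootSystem Φ) (hv : IsChamberVector Φ Φp v)
    {ι : Type*} [Fintype ι] (b : Module.Basis ι ℝ V) (d : ℕ)
    {w : V ≃ₗᵢ[ℝ] V} (hw : w ∈ coxeterGroup Φ) {φ : Finset V} (hφ : IsTwoStructure Φ Φp φ)
    (hk : IsTypeA1Pow k φ) (a : V) :
    IsTwoStructure Φ Φp (φ.image ⇑w⁻¹) ∧
      twoStructureSign Φ Φp φ * evalAt b (taylorOn b d (positivePart Φp φ)) (w a) =
        (coxeterSign Φp w : ℝ) * (twoStructureSign Φ Φp (φ.image ⇑w⁻¹) *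
          evalAt b (taylorOn b d (positivePart Φp (φ.image ⇑w⁻¹))) a) := by
  obtain ⟨f₀, hf₀, hf₀φ⟩ := hk
  obtain ⟨t, hf⟩ := exists_isPositiveFrame hΦ hv hf₀ hf₀φ
    fun i => hφ.subset ((hf₀φ _).2 ⟨i, Or.inl rfl⟩)
  generalize (fun i => if i ∈ t then -f₀ i else f₀ i) = f at hf
  have hw' := inv_mem hw
  have hh : Orthonormal ℝ fun i => w⁻¹ (f i) := hf.orthonormal.comp_linearIsometryEquiv w⁻¹
  have hhΦ : ∀ i, w⁻¹ (f i) ∈ Φ := fun i => hΦ.apply_mem hw' ((hv.2 _).1 (hf.mem i)).1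
  have hhψ : ∀ x, x ∈ φ.image ⇑w⁻¹ ↔ ∃ i, x = w⁻¹ (f i) ∨ x = -w⁻¹ (f i) := by
    intro x
    rw [Finset.mem_image]
    constructor
    · rintro ⟨y, hy, rfl⟩
      obtain ⟨i, rfl | rfl⟩ := (hf.mem_iff y).1 hy
      · exact ⟨i, Or.inl rfl⟩
      · exact ⟨i, Or.inr (map_neg _ _)⟩
    · rintro ⟨i, rfl | rfl⟩
      · exact ⟨f i, (hf.mem_iff _).2 ⟨i, Or.inl rfl⟩, rfl⟩
      · exact ⟨-f i, (hf.mem_iff _).2 ⟨i, Or.inr rfl⟩, map_neg _ _⟩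
  obtain ⟨s, hg⟩ := exists_isPositiveFrame hΦ hv hh hhψ hhΦ
  obtain ⟨r, hr, hrs, hract⟩ := exists_sign_change hΦ hv hh hhΦ s
  have hu := mul_mem hr hw'
  have himg : ⇑(r * w⁻¹) '' (positivePart Φp φ : Set V) =
      (positivePart Φp (φ.image ⇑w⁻¹) : Set V) := by
    rw [hf.coe_positivePart hv, hg.coe_positivePart hv, ← Set.range_comp]
    exact congrArg Set.range (funext hract)
  refine ⟨hφ.of_image hΦ hv hu himg hg, ?_⟩
  rw [twoStructureSign_eq hΦ hv hu himg, hf.evalAt_taylorOn hv, hg.evalAt_taylorOn hv,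
    coxeterSign_mul hΦ hv hr hw', coxeterSign_inv hΦ hv hw, hrs]
  have hneg := eval_taylorPoly_neg (Module.finrank ℝ V) d s fun i => ⟪w⁻¹ (f i), a⟫_ℝ
  have hpt : (fun i => ⟪if i ∈ s then -w⁻¹ (f i) else w⁻¹ (f i), a⟫_ℝ) =
      fun i => if i ∈ s then -⟪w⁻¹ (f i), a⟫_ℝ else ⟪w⁻¹ (f i), a⟫_ℝ := by
    ext i
    split_ifs
    · exact inner_neg_left _ _
    · rfl
  rw [hpt, hneg]
  simp only [inner_inv_apply]
  have h1 : (coxeterSign Φp w : ℝ) * coxeterSign Φp w = 1 := by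
    exact_mod_cast coxeterSign_mul_self Φp w
  have h2 : ((-1 : ℝ) ^ s.card) * (-1) ^ s.card = 1 := by
    rw [← mul_pow]
    simp
  push_cast
  linear_combination (-twoStructureSign Φ Φp φ *
    MvPolynomial.eval (fun i => ⟪f i, w a⟫_ℝ) (taylorPoly (Module.finrank ℝ V) d (Fin k))) *
      (h1 + (coxeterSign Φp w : ℝ) * coxeterSign Φp w * h2)

theorem evalAt_zPoly {ι : Type*} [Fintype ι] (b : Module.Basis ι ℝ V) (d : ℕ) (a : V) :
    evalAt b (zPoly b Φ Φp d) a = ∑ φ ∈ twoStructures Φ Φp,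
      twoStructureSign Φ Φp φ * evalAt b (taylorOn b d (positivePart Φp φ)) a := by
  simp only [evalAt, zPoly, map_sum, map_mul, MvPolynomial.eval_C]

theorem evalAt_zPoly_apply (hΦ : IsPseudoRootSystem Φ) (hv : IsChamberVector Φ Φp v)
    {ι : Type*} [Fintype ι] (b : Module.Basis ι ℝ V) (d : ℕ)
    (hk : ∀ φ ∈ twoStructures Φ Φp, IsTypeA1Pow k φ)
    {w : V ≃ₗᵢ[ℝ] V} (hw : w ∈ coxeterGroup Φ) (a : V) :
    evalAt b (zPoly b Φ Φp d) (w a) =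
      (coxeterSign Φp w : ℝ) * evalAt b (zPoly b Φ Φp d) a := by
  classical
  have hmem : ∀ φ, φ ∈ twoStructures Φ Φp ↔ IsTwoStructure Φ Φp φ := fun φ => by
    rw [twoStructures, Finset.mem_filter, Finset.mem_powerset]
    exact ⟨fun h => h.2, fun h => ⟨h.subset, h⟩⟩
  rw [evalAt_zPoly, evalAt_zPoly, Finset.mul_sum]
  refine Finset.sum_nbij' (fun φ => φ.image ⇑w⁻¹) (fun φ => φ.image ⇑w)
    (fun φ hφ => ?_) (fun φ hφ => ?_) (fun φ _ => ?_) (fun φ _ => ?_) (fun φ hφ => ?_)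
  · exact (hmem _).2 (summand_apply hΦ hv b d hw ((hmem φ).1 hφ) (hk φ hφ) a).1
  · have := (summand_apply hΦ hv b d (inv_mem hw) ((hmem φ).1 hφ) (hk φ hφ) a).1
    rw [inv_inv] at this
    exact (hmem _).2 this
  · rw [Finset.image_image]
    simp
  · rw [Finset.image_image]
    simp
  · exact (summand_apply hΦ hv b d hw ((hmem φ).1 hφ) (hk φ hφ) a).2

/-- A skew-symmetric polynomial vanishes on every `H_α`, and the linear forms `(α, ·)` of the
positive pseudo-roots are pairwise coprime. -/
theorem jacobian_dvd (hΦ : IsPseudoRootSystem Φ) (hv : IsChamberVector Φ Φp v)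
    {ι : Type*} [Fintype ι] (b : Module.Basis ι ℝ V) (p : MvPolynomial ι ℝ)
    (hp : ∀ w ∈ coxeterGroup Φ, ∀ a : V,
      evalAt b p (w a) = (coxeterSign Φp w : ℝ) * evalAt b p a) :
    jacobian b Φp ∣ p := by
  have hne : ∀ α ∈ Φp, α ≠ 0 := by
    rintro α hα rfl
    simpa using ((hv.2 _).1 hα).2
  refine Finset.prod_dvd_of_isRelPrime (fun α hα β hβ hαβ => ?_) fun α hα => ?_
  · refine isRelPrime_pairing b (hne α hα) fun hspan => ?_
    obtain ⟨c, rfl⟩ := Submodule.mem_span_singleton.1 hspan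
    have hα' := (hv.2 _).1 hα
    have hβ' := (hv.2 _).1 hβ
    have hcpos : 0 < c := by
      have := hβ'.2
      rw [real_inner_smul_left] at this
      exact pos_of_mul_pos_left this hα'.2.le
    have hc1 : |c| = 1 := by
      have := hΦ.norm_eq_one _ hβ'.1
      rwa [norm_smul, hΦ.norm_eq_one _ hα'.1, mul_one] at this
    rw [abs_of_pos hcpos] at hc1
    exact hαβ (by rw [hc1, one_smul])
  · have hαΦ := ((hv.2 _).1 hα).1
    rw [pairing_dvd_iff b (hne α hα)]
    intro a ha
    have h := hp _ (rootReflection_mem_coxeterGroup hαΦ) a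
    rw [coxeterSign_rootReflection hΦ hv hαΦ, rootReflection_apply (hΦ.norm_eq_one α hαΦ), ha] at h
    simp only [mul_zero, zero_smul, sub_zero, Int.cast_neg, Int.cast_one] at h
    linarith

end SkewSymmetry

end CoxeterPizza

theorem lemma3p4 {V : Type*} [NormedAddCommGroup V] [InnerProductSpace ℝ V]
    [FiniteDimensional ℝ V] {ι : Type*} [Fintype ι] (b : Module.Basis ι ℝ V)
    (Φ Φp : Finset V) (hΦ : CoxeterPizza.IsPseudoRootSystem Φ)
    (hΦp : CoxeterPizza.IsPositiveSystem Φ Φp)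
    (k : ℕ) (hk : ∀ φ ∈ CoxeterPizza.twoStructures Φ Φp, CoxeterPizza.IsTypeA1Pow k φ) (d : ℕ) :
    (∀ w ∈ CoxeterPizza.coxeterGroup Φ, ∀ a : V,
      CoxeterPizza.evalAt b (CoxeterPizza.zPoly b Φ Φp d) (w a) =
        (CoxeterPizza.coxeterSign Φp w : ℝ) *
          CoxeterPizza.evalAt b (CoxeterPizza.zPoly b Φ Φp d) a) ∧
    CoxeterPizza.jacobian b Φp ∣ CoxeterPizza.zPoly b Φ Φp d := by
  obtain ⟨v, hv⟩ := hΦp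
  have hskew := fun w hw a => CoxeterPizza.evalAt_zPoly_apply hΦ hv b d hk (w := w) hw a
  exact ⟨hskew, CoxeterPizza.jacobian_dvd hΦ hv b _ hskew⟩
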